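/- **Setting.** Let $\hat H=\sum_{j=1}^m \hat H_j$ be a $K$-local Hamiltonian on $n$ qubits: each $\hat H_j$ is Hermitian, has operator norm $\|\hat H_j\|\le 1$ and is supported on at most $K$ qubits, and each qubit lies in the support of at most $K$ of the terms. For a state $\rho=\sum_i\lambda_i|\psi_i\rangle\langle\psi_i|$ (spectral decomposition) the quantum Fisher information for the evolution $e^{-i\theta \hat H/2}\rho\, e^{i\theta \hat H/2}$ is $$\mathcal F(\rho,\hat H)=\tfrac12\sum_{\lambda_i+\lambda_j\ne0}\frac{(\lambda_i-\lambda_j)^2}{\lambda_i+\lambda_j}\,|\langle\psi_i|\hat H|\psi_j\rangle|^2 .$$ A layer is a product of channels acting on disjoint blocks that cover $[n]$; a depth-$t$ circuit $\mathscr C=\mathcal C_t\circ\cdots\circ\mathcal C_1$ is a composition of $t$ layers. A connectivity constraint is a family $\mathcal G$ of allowed blocks. *All-to-all* $\kappa$-local circuits allow all blocks with at most $\kappa$ qubits. In an *$r$-dimensional* system the qubits sit at distinct sites of $\mathbb Z^r$, and a block is allowed if it lies inside some $\kappa\times\cdots\times\kappa$ hypercube of sites, where $\kappa\ge1$. The lightcone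 of a set $A$ through a layer is the union of $A$ and all blocks meeting $A$; the lightcone through a circuit is obtained by iterating over its layers. For a constraint $\mathcal G$, let $g_{\mathcal G}(t)$ be the maximum, over single qubits $q$, of the size of the union of the lightcones of $\{q\}$ through all depth-$t$ circuits allowed by $\mathcal G$. **Theorem.** Suppose that $\rho=\mathscr C(|0^n\rangle\langle 0^n|)$ for a depth-$t$ circuit $\mathscr C$. 1. If $\mathscr C$ obeys the constraint $\mathcal G$, then $\mathcal F(\rho,\hat H)\le mK^2\,g_{\mathcal G}(2t)$. 2. If $\mathscr C$ is $\kappa$-local with all-to-all connectivity, then $\mathcal F(\rho,\hat H)\le mK^2\,\kappa^{2t}$. 3. If $\mathscr C$ is $\kappa$-local in an $r$-dimensional system, then $\mathcal F(\rho,\hat H)\le mK^2\,(2(\kappa-1)\cdot 2t+1)^r$. Moreover, in such a system $g_{\mathcal G}(t)\le(2(\kappa-1)t+1)^r$ for every $t$, with equality if for some qubit every lattice site within sup-norm distance $(\kappa-1)t$ of it is occupied by a qubit. 4. Consequently, for all $K,\kappa,T$ and $c$ there is a constant $c'$ such that $\mathcal F(\rho,\hat H)\le c'n$ for all $n$, every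 $K$-local $\hat H$ on $n$ qubits with $m\le cn$ terms, and every $n$-qubit state $\rho$ prepared from $|0^n\rangle$ by an all-to-all $\kappa$-local circuit of depth at most $T$. 5. Hence beating this scaling requires long-range entanglement: let $(\rho_k)$ be a sequence of states on $n_k$ qubits and $(\hat H_k)$ $K$-local Hamiltonians on $n_k$ qubits with $m_k=O(n_k)$ terms, $K$ being fixed. If $\mathcal F(\rho_k,\hat H_k)$ is not $O(n_k)$, then $(\rho_k)$ is long-range entangled, i.e. there are no constants $\kappa,T$ such that every $\rho_k$ can be prepared from $|0^{n_k}\rangle$ by an all-to-all $\kappa$-local circuit of depth at most $T$. -/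

import Mathlib

noncomputable section

namespace ShallowQFI

open Matrix
open scoped ComplexOrder

/-! ### Qubit systems and supports -/

/-- Operators on the qubits indexed by `ι`, as matrices in the computational basis. -/
abbrev Op (ι : Type) [Fintype ι] : Type := Matrix (ι → Fin 2) (ι → Fin 2) ℂ

/-- The bit string that agrees with `a` on `B` and with `x` outside `B`. -/
def merge {n : ℕ} (B : Finset (Fin n)) (a : B → Fin 2) (x : Fin n → Fin 2) : Fin n → Fin 2 :=
  fun i => if h : i ∈ B then a ⟨i, h⟩ else x i

/-- The operator `O_A ⊗ 𝟙` on all `n` qubits, for an operator `O_A` on the qubits of `A`. -/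
def extendOp {n : ℕ} (A : Finset (Fin n)) (OA : Op A) : Op (Fin n) :=
  open Classical in
  Matrix.of fun x y =>
    if ∀ i, i ∉ A → x i = y i then OA (fun i => x i) (fun i => y i) else 0

/-- `O` has the form `O_A ⊗ 𝟙`, that is, it acts trivially outside `A`. -/
def ActsOn {n : ℕ} (A : Finset (Fin n)) (O : Op (Fin n)) : Prop :=
  ∃ OA : Op A, O = extendOp A OA

/-- The support of `O`: the intersection of all sets of qubits on which `O` acts. By
`actsOn_supp` below, it is the smallest set `A` such that `O = O_A ⊗ 𝟙`. -/
def supp {n : ℕ} (O : Op (Fin n)) : Finset (Fin n) :=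
  open Classical in
  Finset.univ.filter fun i => ∀ A : Finset (Fin n), ActsOn A O → i ∈ A

/-- Acting on `A`, in terms of matrix entries. -/
theorem actsOn_iff {n : ℕ} (A : Finset (Fin n)) (O : Op (Fin n)) :
    ActsOn A O ↔ (∀ x y, O x y ≠ 0 → ∀ i, i ∉ A → x i = y i) ∧
      ∀ x y x' y', (∀ i, i ∉ A → x i = y i) → (∀ i, i ∉ A → x' i = y' i) →
        (∀ i ∈ A, x i = x' i) → (∀ i ∈ A, y i = y' i) → O x y = O x' y' := by
  classical
  constructor
  · rintro ⟨OA, rfl⟩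
    refine ⟨fun x y h => ?_, fun x y x' y' h h' hx hy => ?_⟩
    · by_contra hc
      exact h (by simp only [extendOp, Matrix.of_apply]; rw [if_neg hc])
    · simp only [extendOp, Matrix.of_apply]
      rw [if_pos h, if_pos h']
      congr 1
      · funext i; exact hx i i.2
      · funext i; exact hy i i.2
  · rintro ⟨h1, h2⟩
    refine ⟨Matrix.of fun a b => O (merge A a 0) (merge A b 0), ?_⟩
    ext x y
    simp only [extendOp, Matrix.of_apply]
    split_ifs with h
    · apply h2 _ _ _ _ h
      · intro i hi; simp [merge, hi]
      · intro i hi; simp [merge, hi]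
      · intro i hi; simp [merge, hi]
    · by_contra hc
      exact h (h1 x y hc)

theorem actsOn_univ {n : ℕ} (O : Op (Fin n)) : ActsOn Finset.univ O := by
  rw [actsOn_iff]
  refine ⟨fun x y _ i hi => absurd (Finset.mem_univ i) hi, fun x y x' y' _ _ hx hy => ?_⟩
  rw [show x = x' from funext fun i => hx i (Finset.mem_univ i),
    show y = y' from funext fun i => hy i (Finset.mem_univ i)]

theorem ActsOn.inter {n : ℕ} {A B : Finset (Fin n)} {O : Op (Fin n)}
    (hA : ActsOn A O) (hB : ActsOn B O) : ActsOn (A ∩ B) O := by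
  classical
  rw [actsOn_iff] at hA hB ⊢
  refine ⟨fun x y h i hi => ?_, fun x y x' y' h h' hx hy => ?_⟩
  · by_cases hiA : i ∈ A
    · exact hB.1 x y h i fun hiB => hi (Finset.mem_inter.2 ⟨hiA, hiB⟩)
    · exact hA.1 x y h i hiA
  · -- change the bits outside `A` first, then the bits of `A` outside `B`
    have key : ∀ z z' : Fin n → Fin 2, (∀ i, i ∉ A ∩ B → z i = z' i) →
        O z z' = O (fun i => if i ∈ A then z i else 0) (fun i => if i ∈ A then z' i else 0) := by
      intro z z' hz
      apply hA.2
      · intro i hi; exact hz i fun hc => hi (Finset.mem_inter.1 hc).1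
      · intro i hi; simp [hi]
      · intro i hi; simp [hi]
      · intro i hi; simp [hi]
    rw [key x y h, key x' y' h']
    apply hB.2
    · intro i hi
      have := h i fun hc => hi (Finset.mem_inter.1 hc).2
      simp [this]
    · intro i hi
      have := h' i fun hc => hi (Finset.mem_inter.1 hc).2
      simp [this]
    · intro i hi
      by_cases hiA : i ∈ A
      · simpa [hiA] using hx i (Finset.mem_inter.2 ⟨hiA, hi⟩)
      · simp [hiA]
    · intro i hi
      by_cases hiA : i ∈ A
      · simpa [hiA] using hy i (Finset.mem_inter.2 ⟨hiA, hi⟩)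
      · simp [hiA]

/-- An operator acts on its support. -/
theorem actsOn_supp {n : ℕ} (O : Op (Fin n)) : ActsOn (supp O) O := by
  classical
  have h : ∀ S : Finset (Finset (Fin n)), (∀ A ∈ S, ActsOn A O) → ActsOn (S.inf id) O := by
    intro S
    induction S using Finset.induction_on with
    | empty => intro _; simpa using actsOn_univ O
    | insert A S _ ih =>
      intro hS
      rw [Finset.inf_insert]
      exact (hS A (Finset.mem_insert_self A S)).inter
        (ih fun B hB => hS B (Finset.mem_insert_of_mem hB))
  have h2 := h (Finset.univ.filter fun A => ActsOn A O) (by simp)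
  convert h2 using 1
  ext i
  simp [supp, Finset.mem_inf]

/-- A `K`-local Hamiltonian with `m` terms on `n` qubits: every term is Hermitian, acts on at
most `K` qubits and has operator norm at most `1`, and every qubit lies in the support of at
most `K` terms (counted with multiplicity, that is, by their index). -/
structure LocalHamiltonian (n m K : ℕ) where
  /-- the local terms -/
  term : Fin m → Op (Fin n)
  isHermitian : ∀ j, (term j).IsHermitian
  card_supp_le : ∀ j, (supp (term j)).card ≤ K
  degree_le : ∀ i : Fin n, (Finset.univ.filter fun j => i ∈ supp (term j)).card ≤ K
  norm_le_one : ∀ j, ‖Matrix.toEuclideanCLM (n := Fin n → Fin 2) (𝕜 := ℂ) (term j)‖ ≤ 1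

/-- The Hamiltonian itself, the sum of its terms. -/
def LocalHamiltonian.total {n m K : ℕ} (H : LocalHamiltonian n m K) : Op (Fin n) :=
  ∑ j, H.term j

/-! ### States and quantum Fisher information -/

/-- `n`-qubit states: density matrices. -/
structure QState (n : ℕ) where
  /-- the density matrix -/
  mat : Op (Fin n)
  posSemidef : mat.PosSemidef
  trace_eq_one : mat.trace = 1

/-- The quantum Fisher information of `ρ = ∑ᵢ λᵢ |ψᵢ⟩⟨ψᵢ|` with respect to the evolution
`ρ(θ) = exp(-iθH/2) ρ exp(iθH/2)`:
`½ ∑_{λᵢ + λⱼ ≠ 0} (λᵢ - λⱼ)² / (λᵢ + λⱼ) |⟨ψᵢ|H|ψⱼ⟩|²`. -/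
def qfi {n : ℕ} (ρ : QState n) (H : Op (Fin n)) : ℝ :=
  let ev := ρ.posSemidef.isHermitian.eigenvalues
  let ψ := ρ.posSemidef.isHermitian.eigenvectorBasis
  (1 / 2) * ∑ i, ∑ j,
    if ev i + ev j ≠ 0 then
      (ev i - ev j) ^ 2 / (ev i + ev j) *
        ‖inner ℂ (ψ i) (Matrix.toEuclideanCLM (n := Fin n → Fin 2) (𝕜 := ℂ) H (ψ j))‖ ^ 2
    else 0

/-! ### Channels, layers and circuits -/

/-- The map `Φ ⊗ id` on operators over the product of `d` with a `k`-dimensional ancilla. -/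
def amplify {d : Type} (Φ : Matrix d d ℂ →ₗ[ℂ] Matrix d d ℂ) (k : ℕ)
    (X : Matrix (d × Fin k) (d × Fin k) ℂ) : Matrix (d × Fin k) (d × Fin k) ℂ :=
  Matrix.of fun p q => Φ (Matrix.of fun a b => X (a, p.2) (b, q.2)) p.1 q.1

/-- Quantum channels from a system with basis `d` to itself: completely positive,
trace-preserving linear maps. -/
structure Channel (d : Type) [Fintype d] where
  /-- the underlying linear map -/
  toLin : Matrix d d ℂ →ₗ[ℂ] Matrix d d ℂ
  completelyPositive : ∀ (k : ℕ) (X : Matrix (d × Fin k) (d × Fin k) ℂ),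
    X.PosSemidef → (amplify toLin k X).PosSemidef
  tracePreserving : ∀ X, (toLin X).trace = X.trace

/-- A gate: a channel on the qubits of a set `block`. -/
structure Gate (n : ℕ) where
  /-- the qubits on which the gate acts -/
  block : Finset (Fin n)
  /-- the channel on these qubits -/
  chan : Channel (block → Fin 2)

/-- The action of a gate on all `n` qubits: its channel on `block`, tensored with the identity
channel on the other qubits. -/
def Gate.apply {n : ℕ} (G : Gate n) (X : Op (Fin n)) : Op (Fin n) :=
  Matrix.of fun x y =>
    G.chan.toLin (Matrix.of fun a b => X (merge G.block a x) (merge G.block b y))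
      (fun i => x i) (fun i => y i)

/-- A layer: gates on pairwise disjoint blocks that together cover all qubits. (A qubit on which
nothing happens carries the identity channel.) -/
structure Layer (n : ℕ) where
  /-- the gates of the layer; as their blocks are disjoint, their order does not matter -/
  gates : List (Gate n)
  pairwise_disjoint : gates.Pairwise fun G G' => Disjoint G.block G'.block
  cover : ∀ i : Fin n, ∃ G ∈ gates, i ∈ G.block

/-- The action of a layer: the product of its gates. -/
def Layer.apply {n : ℕ} (L : Layer n) (X : Op (Fin n)) : Op (Fin n) :=
  L.gates.foldl (fun Y G => G.apply Y) X

/-- Circuits `[C₁, …, C_t]`, where `C₁` is applied first; the depth is the length `t`. -/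
abbrev Circuit (n : ℕ) : Type := List (Layer n)

/-- The action `C_t ∘ ⋯ ∘ C₁` of a circuit. -/
def Circuit.apply {n : ℕ} (C : Circuit n) (X : Op (Fin n)) : Op (Fin n) :=
  List.foldl (fun Y L => Layer.apply L Y) X C

/-- The depth of a circuit. -/
def Circuit.depth {n : ℕ} (C : Circuit n) : ℕ := List.length C

/-- The initial state `|0ⁿ⟩⟨0ⁿ|`. -/
def zeroState (n : ℕ) : Op (Fin n) := Matrix.single 0 0 1

/-- The circuit prepares the state `ρ` from `|0ⁿ⟩`. -/
def Circuit.Prepares {n : ℕ} (C : Circuit n) (ρ : QState n) : Prop :=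
  C.apply (zeroState n) = ρ.mat

/-! ### Connectivity and growth of lightcones -/

/-- A connectivity constraint: the set of blocks on which a gate may act. -/
abbrev Connectivity (n : ℕ) : Type := Set (Finset (Fin n))

/-- All gates of the circuit act on blocks that the constraint allows. -/
def Circuit.Obeys {n : ℕ} (C : Circuit n) (𝒢 : Connectivity n) : Prop :=
  ∀ L ∈ C, ∀ G ∈ L.gates, G.block ∈ 𝒢

/-- `κ`-local gates with all-to-all connectivity: any set of at most `κ` qubits. -/
def allToAll (n κ : ℕ) : Connectivity n := {B | B.card ≤ κ}

/-- Gates in `r` dimensions, for qubits located at the sites `pos q` of the lattice `ℤ^r`: every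
gate acts inside some `κ × ⋯ × κ` hypercube of sites. -/
def lattice {n r : ℕ} (pos : Fin n → Fin r → ℤ) (κ : ℕ) : Connectivity n :=
  {B | ∃ c : Fin r → ℤ, ∀ q ∈ B, ∀ i, c i ≤ pos q i ∧ pos q i < c i + κ}

/-- The lightcone of `A` through one layer: `A`, with all blocks that meet `A`. -/
def Layer.lightcone {n : ℕ} (L : Layer n) (A : Finset (Fin n)) : Finset (Fin n) :=
  open Classical in
  A ∪ Finset.univ.filter fun i => ∃ G ∈ L.gates, (G.block ∩ A).Nonempty ∧ i ∈ G.block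

/-- The lightcone of `A` through a circuit. -/
def Circuit.lightcone {n : ℕ} (C : Circuit n) (A : Finset (Fin n)) : Finset (Fin n) :=
  List.foldl (fun A' L => Layer.lightcone L A') A C

/-- The operator diffusion function: the union of the lightcones of `A` through all depth-`t`
circuits that the constraint allows. -/
def diffusion {n : ℕ} (𝒢 : Connectivity n) (t : ℕ) (A : Finset (Fin n)) : Finset (Fin n) :=
  open Classical in
  Finset.univ.filter fun i =>
    ∃ C : Circuit n, C.depth = t ∧ C.Obeys 𝒢 ∧ i ∈ C.lightcone A

/-- The lightcone growth function: the largest size of the diffusion of a single qubit. -/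
def growth {n : ℕ} (𝒢 : Connectivity n) (t : ℕ) : ℕ :=
  Finset.univ.sup fun q : Fin n => (diffusion 𝒢 t {q}).card

/-! ### Families of states -/

/-- The family of states can be prepared by shallow circuits: there are constants `κ` and `T`
such that each of its states is prepared from `|0ⁿ⟩` by a circuit of `κ`-local channels, with
all-to-all connectivity, of depth at most `T`. (As one-qubit channels prepare every product state
in depth one, starting from an arbitrary product state instead gives the same notion.) -/
def IsShallow {n : ℕ → ℕ} (ρ : ∀ k, QState (n k)) : Prop :=
  ∃ κ T : ℕ, ∀ k, ∃ C : Circuit (n k),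
    C.depth ≤ T ∧ C.Obeys (allToAll (n k) κ) ∧ C.Prepares (ρ k)

/-- The family of states is long-range entangled: no shallow circuits prepare it. -/
def IsLongRangeEntangled {n : ℕ → ℕ} (ρ : ∀ k, QState (n k)) : Prop :=
  ¬ IsShallow ρ

end ShallowQFI

end

open ShallowQFI Asymptotics Filter

noncomputable section

namespace ShallowQFI

open Matrix
open scoped ComplexOrder

/-! ### Locality of operators -/

/-! The quantum Fisher information is at most a variance. After shifting the Hamiltonian by a
constant, `(λᵢ - λⱼ)² ≤ (λᵢ + λⱼ)²` bounds each summand by `λᵢ + λⱼ` times a squared matrix element,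
and Parseval sums these to a second moment (`qfi_le_expect`). Centring every local term expands it
into covariances of pairs of terms, each at most `1` by positivity (`QState.expect_mul_re_le_one`).
It remains to count the pairs that can be correlated.

In the Heisenberg picture a gate enlarges the support of an observable by at most its block
(`Gate.exists_dual`) and leaves observables off its block alone. Two observables whose backward
lightcones are disjoint therefore have the same vanishing covariance as in the initial product state
(`Uncorrelated.circuit_apply`). If the cones do meet, one support is reached from the other by
running the circuit backwards and then forwards, which explains the depth `2t`
(`Circuit.exists_mem_lightcone_of_not_disjoint`). Choosing a qubit of the first term, a qubit in its
cone and a term containing the latter gives the factor `K * g * K` per term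
(`qfi_le_of_card_lightcone_le`).

What is left is geometry: a layer of `κ`-local gates multiplies cones by at most `κ`, and a lattice
layer moves each coordinate by at most `κ - 1`. For the lattice this is sharp, since inside a fully
occupied box two-qubit blocks advance at that speed (`exists_circuit_lattice`). -/

theorem ActsOn.mono {n : ℕ} {A B : Finset (Fin n)} {O : Op (Fin n)} (hA : ActsOn A O)
    (h : A ⊆ B) : ActsOn B O := by
  rw [actsOn_iff] at hA ⊢
  refine ⟨fun x y hxy i hi => hA.1 x y hxy i fun hc => hi (h hc),
    fun x y x' y' hxy hxy' hx hy => ?_⟩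
  by_cases hc : ∀ i, i ∉ A → x i = y i
  · have hc' : ∀ i, i ∉ A → x' i = y' i := fun i hi => by
      by_cases hB : i ∈ B
      · rw [← hx i hB, ← hy i hB, hc i hi]
      · exact hxy' i hB
    exact hA.2 x y x' y' hc hc' (fun i hi => hx i (h hi)) (fun i hi => hy i (h hi))
  · have hc' : ¬ ∀ i, i ∉ A → x' i = y' i := fun h' => hc fun i hi => by
      by_cases hB : i ∈ B
      · rw [hx i hB, hy i hB, h' i hi]
      · exact hxy i hB
    rw [not_imp_comm.1 (hA.1 x y) hc, not_imp_comm.1 (hA.1 x' y') hc']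

/-- Only one intermediate bit string survives in the matrix product: `B` forces it to agree with `y`
on `S`, and `A` forces it to agree with `x` off `S`. -/
theorem ActsOn.mul_apply {n : ℕ} {S T : Finset (Fin n)} {A B : Op (Fin n)} (hA : ActsOn S A)
    (hB : ActsOn T B) (h : Disjoint S T) (x y : Fin n → Fin 2) :
    (A * B) x y = A x (fun i => if i ∈ S then y i else x i) *
      B (fun i => if i ∈ S then y i else x i) y := by
  rw [actsOn_iff] at hA hB
  rw [Matrix.mul_apply]
  refine Finset.sum_eq_single _ (fun z _ hz => ?_) (by simp)
  by_contra hc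
  refine hz (funext fun i => ?_)
  by_cases hi : i ∈ S
  · rw [if_pos hi, hB.1 z y (right_ne_zero_of_mul hc) i (Finset.disjoint_left.1 h hi)]
  · rw [if_neg hi, hA.1 x z (left_ne_zero_of_mul hc) i hi]

/-- Both products reduce to a single term, and the two terms have equal factors; if `x` and `y`
differ outside `S ∪ T`, both vanish. -/
theorem ActsOn.commute {n : ℕ} {S T : Finset (Fin n)} {A B : Op (Fin n)} (hA : ActsOn S A)
    (hB : ActsOn T B) (h : Disjoint S T) : Commute A B := by
  ext x y
  rw [hA.mul_apply hB h, hB.mul_apply hA h.symm, mul_comm]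
  rw [actsOn_iff] at hA hB
  by_cases hxy : ∀ i, i ∉ S → i ∉ T → x i = y i
  · congr 1
    · refine hB.2 _ _ _ _ ?_ ?_ ?_ ?_
      · intro i hi; by_cases hS : i ∈ S <;> simp [hS, hxy i, hi]
      · intro i hi; simp [hi]
      · intro i hi; simp [Finset.disjoint_right.1 h hi]
      · intro i hi; simp [hi]
    · refine hA.2 _ _ _ _ ?_ ?_ ?_ ?_
      · intro i hi; simp [hi]
      · intro i hi; by_cases hT : i ∈ T <;> simp [hT, hxy i, hi]
      · intro i hi; simp [Finset.disjoint_left.1 h hi]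
      · intro i hi; simp [hi]
  · push Not at hxy
    obtain ⟨i, hS, hT, hne⟩ := hxy
    rw [not_imp_comm.1 (hB.1 _ y) fun hc => hne (by simpa [hS] using hc i hT),
      not_imp_comm.1 (hA.1 _ y) fun hc => hne (by simpa [hT] using hc i hS)]
    simp

/-- An operator commuting with everything that acts outside `S` acts on `S`. -/
theorem actsOn_of_commute {n : ℕ} {S : Finset (Fin n)} {A : Op (Fin n)}
    (h : ∀ B, ActsOn Sᶜ B → Commute A B) : ActsOn S A := by
  classical
  -- The matrix unit `|u⟩⟨v|` on the qubits outside `S`, tensored with the identity on `S`.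
  let U : (Fin n → Fin 2) → (Fin n → Fin 2) → Op (Fin n) := fun u v => Matrix.of fun x y =>
    if (∀ i ∉ S, x i = u i ∧ y i = v i) ∧ ∀ i ∈ S, x i = y i then 1 else 0
  have hU : ∀ u v, ActsOn Sᶜ (U u v) := by
    intro u v
    rw [actsOn_iff]
    refine ⟨fun x y hxy i hi => ?_, fun x y x' y' hx hy hxx hyy => ?_⟩
    · by_contra hc
      exact hxy (if_neg fun h' => hc (h'.2 i (by simpa using hi)))
    · simp only [Finset.mem_compl, not_not] at hx hy hxx hyy
      simp only [U, Matrix.of_apply]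
      refine if_congr (and_congr ?_ ?_) rfl rfl
      · exact forall₂_congr fun i hi => by rw [hxx i hi, hyy i hi]
      · exact ⟨fun _ => hy, fun _ => hx⟩
  have hmul : ∀ u v x y, (∀ i ∉ S, y i = v i) →
      (A * U u v) x y = A x (fun i => if i ∈ S then y i else u i) := by
    intro u v x y hy
    rw [Matrix.mul_apply, Finset.sum_eq_single fun i => if i ∈ S then y i else u i]
    · simp only [U, Matrix.of_apply]
      rw [if_pos, mul_one]
      exact ⟨fun i hi => ⟨by simp [hi], hy i hi⟩, fun i hi => by simp [hi]⟩
    · intro z _ hz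
      simp only [U, Matrix.of_apply]
      rw [if_neg, mul_zero]
      refine fun hc => hz (funext fun i => ?_)
      by_cases hi : i ∈ S
      · rw [if_pos hi, hc.2 i hi]
      · rw [if_neg hi, (hc.1 i hi).1]
    · simp
  have hmul' : ∀ u v x y, (∀ i ∉ S, x i = u i) →
      (U u v * A) x y = A (fun i => if i ∈ S then x i else v i) y := by
    intro u v x y hy
    rw [Matrix.mul_apply, Finset.sum_eq_single fun i => if i ∈ S then x i else v i]
    · simp only [U, Matrix.of_apply]
      rw [if_pos, one_mul]
      exact ⟨fun i hi => ⟨hy i hi, by simp [hi]⟩, fun i hi => by simp [hi]⟩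
    · intro z _ hz
      simp only [U, Matrix.of_apply]
      rw [if_neg, zero_mul]
      refine fun hc => hz (funext fun i => ?_)
      by_cases hi : i ∈ S
      · rw [if_pos hi, hc.2 i hi]
      · rw [if_neg hi, (hc.1 i hi).2]
    · simp
  rw [actsOn_iff]
  refine ⟨fun x y hxy i hi => ?_, fun x y x' y' hx hx' hxx hyy => ?_⟩
  · by_contra hne
    -- Commuting with the projector onto the outside bits of `y` kills every entry whose row has
    -- other outside bits.
    have h1 := congrFun (congrFun (h _ (hU y y)).eq x) y
    rw [hmul _ _ _ _ fun _ _ => rfl] at h1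
    have h2 : (U y y * A) x y = 0 := by
      rw [Matrix.mul_apply]
      refine Finset.sum_eq_zero fun z _ => ?_
      simp only [U, Matrix.of_apply]
      rw [if_neg fun hc => hne (hc.1 i hi).1, zero_mul]
    rw [h2] at h1
    simp only [ite_self] at h1
    exact hxy h1
  -- The matrix unit carries the common outside bits from those of `x` to those of `x'`, so the
  -- entry cannot depend on them.
  · have h1 := congrFun (congrFun (h _ (hU x x')).eq x) y'
    rw [hmul _ _ _ _ fun i hi => (hx' i hi).symm, hmul' _ _ _ _ fun _ _ => rfl] at h1
    convert h1 using 2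
    · funext i
      by_cases hi : i ∈ S
      · simp [hi, hyy i hi]
      · simp [hi, hx i hi]
    · funext i
      by_cases hi : i ∈ S
      · simp [hi, hxx i hi]
      · simp [hi]

/-- Locality is a commutant condition, and commutants are closed under products. -/
theorem ActsOn.mul {n : ℕ} {S T : Finset (Fin n)} {A B : Op (Fin n)} (hA : ActsOn S A)
    (hB : ActsOn T B) : ActsOn (S ∪ T) (A * B) := by
  refine actsOn_of_commute fun D hD => Commute.mul_left (hA.commute hD ?_) (hB.commute hD ?_)
  · rw [Finset.disjoint_left]; intro i hi; simp [hi]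
  · rw [Finset.disjoint_left]; intro i hi; simp [hi]

/-! ### Duals of gates -/

theorem merge_merge {n : ℕ} (b : Finset (Fin n)) (a c : b → Fin 2) (x : Fin n → Fin 2) :
    merge b a (merge b c x) = merge b a x := by
  funext i
  by_cases hi : i ∈ b <;> simp [merge, hi]

theorem merge_restrict {n : ℕ} (b : Finset (Fin n)) (x : Fin n → Fin 2) :
    merge b (fun i => x i) x = x := by
  funext i
  by_cases hi : i ∈ b <;> simp [merge, hi]

theorem restrict_merge {n : ℕ} (b : Finset (Fin n)) (a : b → Fin 2) (x : Fin n → Fin 2) :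
    (fun i : b => merge b a x i) = a := by
  funext i
  simp [merge]

/-- Summing over the bit strings with prescribed values on `b` does not depend on the values. -/
theorem sum_merge {n : ℕ} (b : Finset (Fin n)) (a c : b → Fin 2) (f : (Fin n → Fin 2) → ℂ) :
    (∑ z, if (fun i : b => z i) = c then f z else 0) =
      ∑ w, if (fun i : b => w i) = a then f (merge b c w) else 0 := by
  rw [← Finset.sum_filter, ← Finset.sum_filter]
  refine Finset.sum_nbij' (merge b a) (merge b c) ?_ ?_ ?_ ?_ ?_
  · intro z _; simp [restrict_merge]
  · intro z _; simp [restrict_merge]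
  · intro z hz
    rw [Finset.mem_filter] at hz
    rw [merge_merge, ← hz.2, merge_restrict]
  · intro z hz
    rw [Finset.mem_filter] at hz
    rw [merge_merge, ← hz.2, merge_restrict]
  · intro z hz
    rw [Finset.mem_filter] at hz
    rw [merge_merge, ← hz.2, merge_restrict]

/-- The map `Φ ⊗ id` on all `n` qubits, for a linear map `Φ` on the operators on `b`. -/
def extendMap {n : ℕ} (b : Finset (Fin n)) (Φ : Op b →ₗ[ℂ] Op b) :
    Op (Fin n) →ₗ[ℂ] Op (Fin n) where
  toFun X := Matrix.of fun x y =>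
    Φ (Matrix.of fun a c => X (merge b a x) (merge b c y)) (fun i => x i) (fun i => y i)
  map_add' X Y := by
    ext x y
    exact congrFun (congrFun (Φ.map_add
      (Matrix.of fun a c => X (merge b a x) (merge b c y))
      (Matrix.of fun a c => Y (merge b a x) (merge b c y))) _) _
  map_smul' k X := by
    ext x y
    exact congrFun (congrFun (Φ.map_smul k
      (Matrix.of fun a c => X (merge b a x) (merge b c y))) _) _

theorem extendMap_apply {n : ℕ} (b : Finset (Fin n)) (Φ : Op b →ₗ[ℂ] Op b) (X : Op (Fin n))
    (x y : Fin n → Fin 2) : extendMap b Φ X x y =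
      Φ (Matrix.of fun a c => X (merge b a x) (merge b c y)) (fun i => x i) (fun i => y i) := rfl

theorem Gate.apply_eq_extendMap {n : ℕ} (G : Gate n) :
    G.apply = extendMap G.block G.chan.toLin := rfl

theorem Gate.trace_apply {n : ℕ} (G : Gate n) (X : Op (Fin n)) :
    (G.apply X).trace = X.trace := by
  -- The strings vanishing on the block serve as representatives of the configurations outside it;
  -- for each of them, trace preservation on the block applies.
  have h : ∀ f : (Fin n → Fin 2) → ℂ, ∑ z, f z =
      ∑ w, if (fun i : G.block => w i) = 0 then ∑ c, f (merge G.block c w) else 0 := by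
    intro f
    calc ∑ z, f z = ∑ z, ∑ c, if (fun i : G.block => z i) = c then f z else 0 := by simp
      _ = ∑ c, ∑ z, if (fun i : G.block => z i) = c then f z else 0 := Finset.sum_comm
      _ = ∑ c, ∑ w, if (fun i : G.block => w i) = 0 then f (merge G.block c w) else 0 :=
        Finset.sum_congr rfl fun c _ => sum_merge _ _ _ _
      _ = _ := by
        rw [Finset.sum_comm]
        refine Finset.sum_congr rfl fun w _ => ?_
        split_ifs <;> simp
  simp only [Matrix.trace, Matrix.diag]
  rw [h fun z => G.apply X z z, h fun z => X z z]
  refine Finset.sum_congr rfl fun w _ => if_congr Iff.rfl ?_ rfl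
  have h2 := G.chan.tracePreserving (Matrix.of fun a b => X (merge G.block a w) (merge G.block b w))
  simp only [Matrix.trace, Matrix.diag, Matrix.of_apply] at h2
  rw [← h2]
  refine Finset.sum_congr rfl fun c _ => ?_
  simp only [Gate.apply, Matrix.of_apply, restrict_merge, merge_merge]

/-- An operator off the block multiplies the block components of `X` only by scalars, which the
linear map `Φ` lets through. -/
theorem extendMap_mul {n : ℕ} (b : Finset (Fin n)) (Φ : Op b →ₗ[ℂ] Op b) {T : Finset (Fin n)}
    {B : Op (Fin n)} (hB : ActsOn T B) (h : Disjoint b T) (X : Op (Fin n)) :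
    extendMap b Φ (X * B) = extendMap b Φ X * B := by
  rw [actsOn_iff] at hB
  ext x y
  have key : (Matrix.of fun a c => (X * B) (merge b a x) (merge b c y)) =
      ∑ w, (if (fun i : b => w i) = (fun i : b => y i) then B w y else 0) •
        (Matrix.of fun a c => X (merge b a x) (merge b c w)) := by
    ext a c
    rw [Matrix.sum_apply]
    trans ∑ z, if (fun i : b => z i) = c then
        X (merge b a x) z * B z (merge b c y) else 0
    · rw [Matrix.of_apply, Matrix.mul_apply]
      refine Finset.sum_congr rfl fun z _ => ?_
      split_ifs with hz
      · rfl
      · rw [mul_eq_zero]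
        refine .inr (not_imp_comm.1 (hB.1 _ _) fun hc => hz (funext fun i => ?_))
        rw [hc i (Finset.disjoint_left.1 h i.2)]
        simp [merge]
    · rw [sum_merge b (fun i : b => y i)]
      refine Finset.sum_congr rfl fun w _ => ?_
      rw [Matrix.smul_apply, Matrix.of_apply]
      split_ifs with hw
      · rw [smul_eq_mul, mul_comm]
        congr 1
        by_cases hc : ∀ i, i ∉ T → w i = y i
        · refine hB.2 _ _ _ _ ?_ hc ?_ ?_
          · intro i hi; by_cases hib : i ∈ b <;> simp [merge, hib, hc i hi]
          · intro i hi; simp [merge, Finset.disjoint_right.1 h hi]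
          · intro i hi; simp [merge, Finset.disjoint_right.1 h hi]
        · rw [not_imp_comm.1 (hB.1 w y) hc, not_imp_comm.1 (hB.1 _ _)]
          refine fun h' => hc fun i hi => ?_
          by_cases hib : i ∈ b
          · exact congrFun hw ⟨i, hib⟩
          · simpa [merge, hib] using h' i hi
      · rw [zero_smul]
  rw [extendMap_apply, key, map_sum, Matrix.sum_apply, Matrix.mul_apply]
  refine Finset.sum_congr rfl fun w _ => ?_
  rw [map_smul, Matrix.smul_apply, smul_eq_mul, mul_comm]
  rw [extendMap_apply]
  split_ifs with hw
  · rw [hw]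
  · rw [mul_zero, not_imp_comm.1 (hB.1 w y) fun hc => hw
      (funext fun i => hc i (Finset.disjoint_left.1 h i.2)), mul_zero]

theorem ActsOn.transpose {n : ℕ} {T : Finset (Fin n)} {B : Op (Fin n)} (hB : ActsOn T B) :
    ActsOn T Bᵀ := by
  rw [actsOn_iff] at hB ⊢
  exact ⟨fun x y h i hi => (hB.1 y x h i hi).symm, fun x y x' y' h h' hx hy =>
    hB.2 y x y' x' (fun i hi => (h i hi).symm) (fun i hi => (h' i hi).symm) hy hx⟩

theorem mul_extendMap {n : ℕ} (b : Finset (Fin n)) (Φ : Op b →ₗ[ℂ] Op b) {T : Finset (Fin n)}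
    {B : Op (Fin n)} (hB : ActsOn T B) (h : Disjoint b T) (X : Op (Fin n)) :
    extendMap b Φ (B * X) = B * extendMap b Φ X := by
  let Ψ : Op b →ₗ[ℂ] Op b := (transposeLinearEquiv _ _ ℂ ℂ).toLinearMap ∘ₗ Φ ∘ₗ
    (transposeLinearEquiv _ _ ℂ ℂ).toLinearMap
  -- Conjugating `Φ` by transposition exchanges left and right multiplication.
  have hΨ : ∀ Y, (extendMap b Φ Y)ᵀ = extendMap b Ψ Yᵀ := fun Y => rfl
  rw [← transpose_inj, hΨ, transpose_mul, extendMap_mul b Ψ hB.transpose h, transpose_mul, hΨ]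

/-- The Heisenberg picture of a gate: an observable on `S` pulls back to one on `S ∪ G.block`. -/
theorem Gate.exists_dual {n : ℕ} (G : Gate n) {S : Finset (Fin n)} {A : Op (Fin n)}
    (hA : ActsOn S A) :
    ∃ A', ActsOn (S ∪ G.block) A' ∧ ∀ X, (G.apply X * A).trace = (X * A').trace := by
  -- The dual observable is read off from the trace functional on matrix units.
  let A' : Op (Fin n) := Matrix.of fun y x => (G.apply (Matrix.single x y 1) * A).trace
  have hA' : ∀ X, (G.apply X * A).trace = (X * A').trace := by
    intro X
    let f : Op (Fin n) →ₗ[ℂ] ℂ := Matrix.traceLinearMap _ ℂ ℂ ∘ₗ LinearMap.mulRight ℂ A ∘ₗ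
      extendMap G.block G.chan.toLin
    let g : Op (Fin n) →ₗ[ℂ] ℂ := Matrix.traceLinearMap _ ℂ ℂ ∘ₗ LinearMap.mulRight ℂ A'
    have hfg : f = g := by
      refine Matrix.ext_linearMap _ fun x y => LinearMap.ext_ring ?_
      change (G.apply (Matrix.single x y 1) * A).trace = (Matrix.single x y 1 * A').trace
      rw [Matrix.trace_single_mul, one_smul]
      rfl
    exact congrArg (· X) hfg
  refine ⟨A', actsOn_of_commute fun B hB => ?_, hA'⟩
  have hd : Disjoint G.block (S ∪ G.block)ᶜ := by
    rw [Finset.disjoint_left]; intro i hi; simp [hi]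
  have hd' : Disjoint S (S ∪ G.block)ᶜ := by
    rw [Finset.disjoint_left]; intro i hi; simp [hi]
  -- Testing against all `X`, cyclicity and duality reduce the claim to `B` passing through both the
  -- channel and `A`.
  refine Matrix.ext_iff_trace_mul_left.2 fun X => ?_
  rw [← Matrix.mul_assoc, Matrix.trace_mul_cycle, ← hA', Gate.apply_eq_extendMap,
    mul_extendMap _ _ hB hd, ← Matrix.mul_assoc, ← hA', Gate.apply_eq_extendMap,
    extendMap_mul _ _ hB hd, Matrix.mul_assoc _ B A,
    ← (hA.commute hB hd').eq, ← Matrix.mul_assoc, Matrix.trace_mul_cycle _ A B]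

/-! ### Lightcones and correlations -/

/-- In the operator `X`, observables on `S` and on `T` have vanishing correlations. -/
def Uncorrelated {n : ℕ} (X : Op (Fin n)) (S T : Finset (Fin n)) : Prop :=
  ∀ A B, ActsOn S A → ActsOn T B → (X * A * B).trace = (X * A).trace * (X * B).trace

theorem Uncorrelated.mono {n : ℕ} {X : Op (Fin n)} {S T S' T' : Finset (Fin n)}
    (h : Uncorrelated X S T) (hS : S' ⊆ S) (hT : T' ⊆ T) : Uncorrelated X S' T' :=
  fun A B hA hB => h A B (hA.mono hS) (hB.mono hT)

theorem Uncorrelated.symm {n : ℕ} {X : Op (Fin n)} {S T : Finset (Fin n)}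
    (h : Uncorrelated X S T) (hST : Disjoint S T) : Uncorrelated X T S := by
  intro A B hA hB
  rw [Matrix.mul_assoc, (hA.commute hB hST.symm).eq, ← Matrix.mul_assoc, h B A hB hA, mul_comm]

/-- The expectation is the entry at `(0, 0)`, and the only intermediate string in that entry of `A *
B` is `0` again. -/
theorem uncorrelated_zeroState {n : ℕ} {S T : Finset (Fin n)} (h : Disjoint S T) :
    Uncorrelated (zeroState n) S T := by
  intro A B hA hB
  rw [Matrix.mul_assoc, zeroState, Matrix.trace_single_mul, Matrix.trace_single_mul,
    Matrix.trace_single_mul, hA.mul_apply hB h]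
  have : (fun i => if i ∈ S then (0 : Fin n → Fin 2) i else (0 : Fin n → Fin 2) i) = 0 := by
    funext i; simp
  rw [this]
  simp

/-- No signalling: the observable slips inside the channel, which then preserves the trace. -/
theorem Gate.trace_apply_mul {n : ℕ} (G : Gate n) {T : Finset (Fin n)} {B : Op (Fin n)}
    (hB : ActsOn T B) (h : Disjoint G.block T) (X : Op (Fin n)) :
    (G.apply X * B).trace = (X * B).trace := by
  rw [Gate.apply_eq_extendMap, ← extendMap_mul _ _ hB h, ← Gate.apply_eq_extendMap,
    Gate.trace_apply]

/-- Only `A` needs to be pulled back to its dual; `B` passes through the channel unchanged. -/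
theorem Uncorrelated.gate_apply_of_disjoint_right {n : ℕ} (G : Gate n) {X : Op (Fin n)}
    {S T : Finset (Fin n)} (h : Uncorrelated X (S ∪ G.block) T) (hST : Disjoint S T)
    (hT : Disjoint G.block T) : Uncorrelated (G.apply X) S T := by
  intro A B hA hB
  obtain ⟨A', hA', hd⟩ := G.exists_dual hA
  rw [G.trace_apply_mul hB hT, hd, ← h A' B hA' hB, Matrix.mul_assoc, (hA.commute hB hST).eq,
    ← Matrix.mul_assoc, Gate.apply_eq_extendMap, ← extendMap_mul _ _ hB hT,
    ← Gate.apply_eq_extendMap, hd, Matrix.mul_assoc X B, Matrix.mul_assoc X A',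
    (hA'.commute hB ?_).eq]
  exact Finset.disjoint_union_left.2 ⟨hST, hT⟩

/-- A block meeting both `S` and `T` would lie in both of the disjoint sets `S'` and `T'`, so at
least one of the observables is untouched by the gate. -/
theorem Uncorrelated.gate_apply {n : ℕ} (G : Gate n) {X : Op (Fin n)} {S T S' T' : Finset (Fin n)}
    (h : Uncorrelated X S' T') (hd : Disjoint S' T') (hS : S ⊆ S') (hT : T ⊆ T')
    (hGS : ¬ Disjoint G.block S → G.block ⊆ S') (hGT : ¬ Disjoint G.block T → G.block ⊆ T') :
    Uncorrelated (G.apply X) S T := by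
  have hST : Disjoint S T := hd.mono hS hT
  by_cases h1 : Disjoint G.block S
  · by_cases h2 : Disjoint G.block T
    · intro A B hA hB
      rw [Matrix.mul_assoc, G.trace_apply_mul (hA.mul hB) (Finset.disjoint_union_right.2 ⟨h1, h2⟩),
        G.trace_apply_mul hA h1, G.trace_apply_mul hB h2, ← Matrix.mul_assoc,
        h.mono hS hT A B hA hB]
    · refine (gate_apply_of_disjoint_right G ?_ hST.symm h1).symm hST.symm
      exact (h.symm hd).mono (Finset.union_subset hT (hGT h2)) hS
  · refine gate_apply_of_disjoint_right G ?_ hST (hd.mono (hGS h1) hT)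
    exact h.mono (Finset.union_subset hS (hGS h1)) hT

/-- The set `A` together with the blocks of a list of gates that meet `A`. -/
def gatesCone {n : ℕ} (gs : List (Gate n)) (A : Finset (Fin n)) : Finset (Fin n) :=
  open Classical in
  A ∪ Finset.univ.filter fun i => ∃ G ∈ gs, (G.block ∩ A).Nonempty ∧ i ∈ G.block

theorem subset_gatesCone {n : ℕ} (gs : List (Gate n)) (A : Finset (Fin n)) : A ⊆ gatesCone gs A :=
  Finset.subset_union_left

theorem mem_gatesCone {n : ℕ} {gs : List (Gate n)} {A : Finset (Fin n)} {i : Fin n} :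
    i ∈ gatesCone gs A ↔ i ∈ A ∨ ∃ G ∈ gs, (G.block ∩ A).Nonempty ∧ i ∈ G.block := by
  simp [gatesCone]

theorem gatesCone_subset_cons {n : ℕ} (G : Gate n) (gs : List (Gate n)) (A : Finset (Fin n)) :
    gatesCone gs A ⊆ gatesCone (G :: gs) A := by
  intro i
  rw [mem_gatesCone, mem_gatesCone]
  rintro (h | ⟨G', h, h'⟩)
  · exact .inl h
  · exact .inr ⟨G', List.mem_cons_of_mem _ h, h'⟩

/-- The other blocks are disjoint from that of `G`, so it can meet their cone only in `A` itself.
Hence applying the gates one by one grows no more than the cone of a single layer. -/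
theorem block_subset_gatesCone {n : ℕ} {G : Gate n} {gs : List (Gate n)} {A : Finset (Fin n)}
    (hG : ∀ G' ∈ gs, Disjoint G.block G'.block) (h : ¬ Disjoint G.block (gatesCone gs A)) :
    G.block ⊆ gatesCone (G :: gs) A := by
  rw [Finset.not_disjoint_iff] at h
  obtain ⟨i, hi, hi'⟩ := h
  rw [mem_gatesCone] at hi'
  intro j hj
  rcases hi' with hA | ⟨G', hG', -, h⟩
  · exact mem_gatesCone.2 (.inr ⟨G, List.mem_cons_self, ⟨i, Finset.mem_inter.2 ⟨hi, hA⟩⟩, hj⟩)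
  · exact absurd h (Finset.disjoint_left.1 (hG G' hG') hi)

theorem Uncorrelated.foldl_gates {n : ℕ} {gs : List (Gate n)}
    (hgs : gs.Pairwise fun G G' => Disjoint G.block G'.block) {X : Op (Fin n)}
    {S T : Finset (Fin n)} (h : Uncorrelated X (gatesCone gs S) (gatesCone gs T))
    (hd : Disjoint (gatesCone gs S) (gatesCone gs T)) :
    Uncorrelated (gs.foldl (fun Y G => G.apply Y) X) S T := by
  induction gs generalizing X with
  | nil => exact h.mono (subset_gatesCone _ _) (subset_gatesCone _ _)
  | cons G gs ih =>
    rw [List.pairwise_cons] at hgs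
    refine ih hgs.2 ?_ (hd.mono (gatesCone_subset_cons _ _ _) (gatesCone_subset_cons _ _ _))
    exact h.gate_apply G hd (gatesCone_subset_cons _ _ _) (gatesCone_subset_cons _ _ _)
      (block_subset_gatesCone hgs.1) (block_subset_gatesCone hgs.1)

theorem Uncorrelated.layer_apply {n : ℕ} (L : Layer n) {X : Op (Fin n)} {S T : Finset (Fin n)}
    (h : Uncorrelated X (L.lightcone S) (L.lightcone T))
    (hd : Disjoint (L.lightcone S) (L.lightcone T)) : Uncorrelated (L.apply X) S T :=
  foldl_gates L.pairwise_disjoint h hd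

theorem Layer.subset_lightcone {n : ℕ} (L : Layer n) (A : Finset (Fin n)) : A ⊆ L.lightcone A :=
  Finset.subset_union_left

theorem Circuit.subset_lightcone {n : ℕ} (C : Circuit n) (A : Finset (Fin n)) :
    A ⊆ C.lightcone A := by
  induction C generalizing A with
  | nil => exact subset_rfl
  | cons L C ih => exact (L.subset_lightcone A).trans (ih _)

theorem Circuit.lightcone_append {n : ℕ} (C D : Circuit n) (A : Finset (Fin n)) :
    Circuit.lightcone (C ++ D) A = D.lightcone (C.lightcone A) :=
  List.foldl_append

/-- Correlations spread at most along the backward lightcones of a circuit. -/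
theorem Uncorrelated.circuit_apply {n : ℕ} (C : Circuit n) {X : Op (Fin n)}
    (hX : ∀ S T, Disjoint S T → Uncorrelated X S T) {S T : Finset (Fin n)}
    (hd : Disjoint (Circuit.lightcone C.reverse S) (Circuit.lightcone C.reverse T)) :
    Uncorrelated (C.apply X) S T := by
  induction C using List.reverseRecOn generalizing S T with
  | nil => exact hX _ _ hd
  | append_singleton C L ih =>
    rw [List.reverse_append] at hd
    have h : Circuit.apply (C ++ [L]) X = L.apply (Circuit.apply C X) := List.foldl_append
    rw [h]
    exact layer_apply L (ih hd)
      (hd.mono (Circuit.subset_lightcone _ _) (Circuit.subset_lightcone _ _))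

/-! ### The lightcone as a symmetric relation -/

/-- As the blocks cover all qubits, a point of `A` also reaches itself through a block. This leaves
a relation, sharing a block, that is visibly symmetric. -/
theorem Layer.mem_lightcone {n : ℕ} {L : Layer n} {A : Finset (Fin n)} {i : Fin n} :
    i ∈ L.lightcone A ↔ ∃ a ∈ A, ∃ G ∈ L.gates, a ∈ G.block ∧ i ∈ G.block := by
  simp only [Layer.lightcone, Finset.mem_union, Finset.mem_filter, Finset.mem_univ, true_and]
  constructor
  · rintro (h | ⟨G, hG, ⟨a, ha⟩, hi⟩)
    · obtain ⟨G, hG, hi⟩ := L.cover i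
      exact ⟨i, h, G, hG, hi, hi⟩
    · rw [Finset.mem_inter] at ha
      exact ⟨a, ha.2, G, hG, ha.1, hi⟩
  · rintro ⟨a, ha, G, hG, haG, hi⟩
    exact .inr ⟨G, hG, ⟨a, Finset.mem_inter.2 ⟨haG, ha⟩⟩, hi⟩

theorem Circuit.mem_lightcone {n : ℕ} {C : Circuit n} {A : Finset (Fin n)} {i : Fin n} :
    i ∈ C.lightcone A ↔ ∃ a ∈ A, i ∈ C.lightcone {a} := by
  induction C generalizing A with
  | nil => simp [Circuit.lightcone]
  | cons L C ih =>
    change i ∈ Circuit.lightcone C (L.lightcone A) ↔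
      ∃ a ∈ A, i ∈ Circuit.lightcone C (L.lightcone {a})
    rw [ih]
    constructor
    · rintro ⟨b, hb, hi⟩
      obtain ⟨a, ha, h⟩ := Layer.mem_lightcone.1 hb
      exact ⟨a, ha, ih.2 ⟨b, Layer.mem_lightcone.2 ⟨a, Finset.mem_singleton_self a, h⟩, hi⟩⟩
    · rintro ⟨a, ha, hi⟩
      obtain ⟨b, hb, hi⟩ := ih.1 hi
      obtain ⟨a', ha', h⟩ := Layer.mem_lightcone.1 hb
      rw [Finset.mem_singleton.1 ha'] at h
      exact ⟨b, Layer.mem_lightcone.2 ⟨a, ha, h⟩, hi⟩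

theorem Layer.mem_lightcone_comm {n : ℕ} {L : Layer n} {i j : Fin n} :
    i ∈ L.lightcone {j} ↔ j ∈ L.lightcone {i} := by
  simp only [Layer.mem_lightcone, Finset.mem_singleton, exists_eq_left]
  simp only [and_comm]

/-- Each layer is a symmetric relation, so composing in reverse order gives the converse relation.
-/
theorem Circuit.mem_lightcone_reverse {n : ℕ} {C : Circuit n} {i j : Fin n} :
    i ∈ Circuit.lightcone C.reverse {j} ↔ j ∈ C.lightcone {i} := by
  induction C generalizing i j with
  | nil => simp [Circuit.lightcone, eq_comm]
  | cons L C ih =>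
    rw [List.reverse_cons, Circuit.lightcone_append]
    change i ∈ L.lightcone _ ↔ j ∈ Circuit.lightcone C (L.lightcone {i})
    rw [Circuit.mem_lightcone]
    constructor
    · intro h
      obtain ⟨a, ha, h⟩ := Layer.mem_lightcone.1 h
      refine ⟨a, Layer.mem_lightcone_comm.1 (Layer.mem_lightcone.2 ⟨a, by simp, h⟩), ih.1 ha⟩
    · rintro ⟨a, ha, h⟩
      have := Layer.mem_lightcone.1 (Layer.mem_lightcone_comm.1 ha)
      simp only [Finset.mem_singleton, exists_eq_left] at this
      exact Layer.mem_lightcone.2 ⟨a, ih.2 h, this⟩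

/-- If backward lightcones of `A` and `B` meet, then `B` meets the lightcone of `A` through the
circuit run backwards and then forwards. -/
theorem Circuit.exists_mem_lightcone_of_not_disjoint {n : ℕ} {C : Circuit n}
    {A B : Finset (Fin n)}
    (h : ¬ Disjoint (Circuit.lightcone C.reverse A) (Circuit.lightcone C.reverse B)) :
    ∃ a ∈ A, ∃ b ∈ B, b ∈ Circuit.lightcone (C.reverse ++ C) {a} := by
  obtain ⟨i, hA, hB⟩ := Finset.not_disjoint_iff.1 h
  obtain ⟨a, ha, hia⟩ := Circuit.mem_lightcone.1 hA
  obtain ⟨b, hb, hib⟩ := Circuit.mem_lightcone.1 hB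
  rw [Circuit.mem_lightcone_reverse] at hib
  exact ⟨a, ha, b, hb, by
    rw [Circuit.lightcone_append]; exact Circuit.mem_lightcone.2 ⟨i, hia, hib⟩⟩

/-! ### Quantum Fisher information and variance -/

/-- The expectation value of `A` in the state `ρ`. -/
def QState.expect {n : ℕ} (ρ : QState n) (A : Op (Fin n)) : ℂ := (ρ.mat * A).trace

/-- The operator `A` as a continuous linear map on the Hilbert space. -/
abbrev opCLM {n : ℕ} (A : Op (Fin n)) :
    EuclideanSpace ℂ (Fin n → Fin 2) →L[ℂ] EuclideanSpace ℂ (Fin n → Fin 2) :=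
  Matrix.toEuclideanCLM (n := Fin n → Fin 2) (𝕜 := ℂ) A

theorem inner_opCLM_left {n : ℕ} (A : Op (Fin n)) (x y : EuclideanSpace ℂ (Fin n → Fin 2)) :
    inner ℂ (opCLM A x) y = inner ℂ x (opCLM Aᴴ y) := by
  rw [opCLM, opCLM, ← Matrix.star_eq_conjTranspose, map_star,
    ContinuousLinearMap.star_eq_adjoint, ContinuousLinearMap.adjoint_inner_right]

/-- The eigenvalues of the density matrix. -/
abbrev QState.ev {n : ℕ} (ρ : QState n) : (Fin n → Fin 2) → ℝ :=
  ρ.posSemidef.isHermitian.eigenvalues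

/-- The eigenvectors of the density matrix. -/
abbrev QState.basis {n : ℕ} (ρ : QState n) :
    OrthonormalBasis (Fin n → Fin 2) ℂ (EuclideanSpace ℂ (Fin n → Fin 2)) :=
  ρ.posSemidef.isHermitian.eigenvectorBasis

theorem QState.ev_nonneg {n : ℕ} (ρ : QState n) (i : Fin n → Fin 2) : 0 ≤ ρ.ev i :=
  ρ.posSemidef.eigenvalues_nonneg i

theorem QState.expect_eq_sum {n : ℕ} (ρ : QState n) (A : Op (Fin n)) :
    ρ.expect A = ∑ i, (ρ.ev i : ℂ) * inner ℂ (ρ.basis i) (opCLM A (ρ.basis i)) := by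
  have htr : ∀ B : Op (Fin n), B.trace = ∑ i, inner ℂ (ρ.basis i) (opCLM B (ρ.basis i)) := by
    intro B
    rw [← Matrix.trace_toLin_eq B (EuclideanSpace.basisFun (Fin n → Fin 2) ℂ).toBasis,
      ← Matrix.toEuclideanLin_eq_toLin_orthonormal,
      LinearMap.trace_eq_sum_inner _ ρ.basis]
    rfl
  have hev : ∀ i, opCLM ρ.mat (ρ.basis i) = (ρ.ev i : ℂ) • ρ.basis i := by
    intro i
    ext x
    exact congrFun (ρ.posSemidef.isHermitian.mulVec_eigenvectorBasis i) x
  rw [expect, Matrix.trace_mul_comm, htr]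
  refine Finset.sum_congr rfl fun i _ => ?_
  rw [opCLM, map_mul, mul_apply_eq_comp, hev, map_smul, inner_smul_right]

theorem QState.expect_sub {n : ℕ} (ρ : QState n) (A B : Op (Fin n)) :
    ρ.expect (A - B) = ρ.expect A - ρ.expect B := by
  simp [expect, Matrix.mul_sub]

theorem QState.expect_smul {n : ℕ} (ρ : QState n) (c : ℂ) (A : Op (Fin n)) :
    ρ.expect (c • A) = c * ρ.expect A := by
  simp [expect]

theorem QState.expect_one {n : ℕ} (ρ : QState n) : ρ.expect 1 = 1 := by
  simp [expect, ρ.trace_eq_one]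

theorem QState.expect_sum {n : ℕ} (ρ : QState n) {ι : Type} (s : Finset ι) (A : ι → Op (Fin n)) :
    ρ.expect (∑ i ∈ s, A i) = ∑ i ∈ s, ρ.expect (A i) := by
  simp [expect, Matrix.mul_sum, Matrix.trace_sum]

theorem QState.sum_ev {n : ℕ} (ρ : QState n) : ∑ i, ρ.ev i = 1 := by
  have h := ρ.expect_eq_sum 1
  rw [expect_one] at h
  simp only [opCLM, map_one, one_apply_eq_self, inner_self_eq_norm_sq_to_K,
    ρ.basis.norm_eq_one] at h
  simp at h
  exact_mod_cast h.symm

theorem QState.expect_conjTranspose_mul_self {n : ℕ} (ρ : QState n) (A : Op (Fin n)) :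
    ρ.expect (Aᴴ * A) = (∑ i, ρ.ev i * ‖opCLM A (ρ.basis i)‖ ^ 2 : ℝ) := by
  rw [expect_eq_sum]
  push_cast
  refine Finset.sum_congr rfl fun i _ => ?_
  rw [opCLM, map_mul, mul_apply_eq_comp, ← opCLM, ← opCLM, ← inner_opCLM_left,
    inner_self_eq_norm_sq_to_K]
  rfl

theorem QState.expect_conj {n : ℕ} (ρ : QState n) (A : Op (Fin n)) :
    star (ρ.expect A) = ρ.expect Aᴴ := by
  rw [expect_eq_sum, expect_eq_sum, star_sum]
  refine Finset.sum_congr rfl fun i _ => ?_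
  rw [← inner_opCLM_left, star_mul']
  simp

theorem QState.expect_mul_self_re_nonneg {n : ℕ} (ρ : QState n) {A : Op (Fin n)}
    (hA : A.IsHermitian) : 0 ≤ (ρ.expect (A * A)).re := by
  have h := ρ.expect_conjTranspose_mul_self A
  rw [hA.eq] at h
  rw [h, Complex.ofReal_re]
  exact Finset.sum_nonneg fun i _ => mul_nonneg (ρ.ev_nonneg i) (sq_nonneg _)

theorem QState.expect_mul_self_re_le_one {n : ℕ} (ρ : QState n) {A : Op (Fin n)}
    (hA : A.IsHermitian) (h1 : ‖opCLM A‖ ≤ 1) : (ρ.expect (A * A)).re ≤ 1 := by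
  have h := ρ.expect_conjTranspose_mul_self A
  rw [hA.eq] at h
  rw [h, Complex.ofReal_re, ← ρ.sum_ev]
  refine Finset.sum_le_sum fun i _ => mul_le_of_le_one_right (ρ.ev_nonneg i) ?_
  refine pow_le_one₀ (norm_nonneg _) ?_
  refine ((opCLM A).le_of_opNorm_le h1 _).trans ?_
  rw [ρ.basis.norm_eq_one, one_mul]

theorem qfi_nonneg {n : ℕ} (ρ : QState n) (H : Op (Fin n)) : 0 ≤ qfi ρ H := by
  refine mul_nonneg (by norm_num) (Finset.sum_nonneg fun i _ => Finset.sum_nonneg fun j _ => ?_)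
  split_ifs
  · exact mul_nonneg (div_nonneg (sq_nonneg _) (add_nonneg (ρ.ev_nonneg i) (ρ.ev_nonneg j)))
      (sq_nonneg _)
  · exact le_rfl

theorem isHermitian_sub_smul_one {n : ℕ} {A : Op (Fin n)} (hA : A.IsHermitian) (c : ℝ) :
    (A - (c : ℂ) • (1 : Op (Fin n))).IsHermitian := by
  refine hA.sub ?_
  rw [Matrix.IsHermitian, Matrix.conjTranspose_smul, Matrix.conjTranspose_one]
  simp

/-- The quantum Fisher information is at most the second moment about any real number. -/
theorem qfi_le_expect {n : ℕ} (ρ : QState n) {H : Op (Fin n)} (hH : H.IsHermitian) (c : ℝ) :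
    qfi ρ H ≤ (ρ.expect ((H - (c : ℂ) • 1) * (H - (c : ℂ) • 1))).re := by
  set A : Op (Fin n) := H - (c : ℂ) • 1 with hA
  have hAH : A.IsHermitian := isHermitian_sub_smul_one hH c
  have hterm : ∀ i j, (if ρ.ev i + ρ.ev j ≠ 0 then
      (ρ.ev i - ρ.ev j) ^ 2 / (ρ.ev i + ρ.ev j) *
        ‖inner ℂ (ρ.basis i) (opCLM H (ρ.basis j))‖ ^ 2 else 0) ≤
      (ρ.ev i + ρ.ev j) * ‖inner ℂ (ρ.basis i) (opCLM A (ρ.basis j))‖ ^ 2 := by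
    intro i j
    have hi := ρ.ev_nonneg i
    have hj := ρ.ev_nonneg j
    split_ifs with h
    · by_cases hij : i = j
      · subst hij
        simp only [sub_self, ne_eq, OfNat.ofNat_ne_zero, not_false_eq_true, zero_pow, zero_div,
          zero_mul]
        positivity
      -- The shift by a multiple of the identity is invisible off the diagonal.
      · have h0 : inner ℂ (ρ.basis i) (opCLM A (ρ.basis j)) =
            inner ℂ (ρ.basis i) (opCLM H (ρ.basis j)) := by
          rw [hA, opCLM, map_sub, map_smul, map_one]
          simp [ρ.basis.inner_eq_zero hij]
        rw [h0]
        refine mul_le_mul_of_nonneg_right ?_ (sq_nonneg _)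
        rw [div_le_iff₀ (lt_of_le_of_ne (add_nonneg hi hj) (Ne.symm h))]
        nlinarith [mul_nonneg hi hj]
    · positivity
  have hsum : ∀ j, ∑ i, ‖inner ℂ (ρ.basis i) (opCLM A (ρ.basis j))‖ ^ 2 =
      ‖opCLM A (ρ.basis j)‖ ^ 2 := fun j => ρ.basis.sum_sq_norm_inner_right _
  have hsum' : ∀ i, ∑ j, ‖inner ℂ (ρ.basis i) (opCLM A (ρ.basis j))‖ ^ 2 =
      ‖opCLM A (ρ.basis i)‖ ^ 2 := fun i => by
    rw [← hsum i]
    refine Finset.sum_congr rfl fun j _ => ?_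
    have h2 := inner_opCLM_left A (ρ.basis i) (ρ.basis j)
    rw [hAH.eq] at h2
    rw [← h2, norm_inner_symm]
  have hE := ρ.expect_conjTranspose_mul_self A
  rw [hAH.eq] at hE
  rw [hE, Complex.ofReal_re]
  calc qfi ρ H ≤ (1 / 2) * ∑ i, ∑ j,
        (ρ.ev i + ρ.ev j) * ‖inner ℂ (ρ.basis i) (opCLM A (ρ.basis j))‖ ^ 2 :=
        mul_le_mul_of_nonneg_left
          (Finset.sum_le_sum fun i _ => Finset.sum_le_sum fun j _ => hterm i j) (by norm_num)
    _ = _ := by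
      -- The two weights give equal sums, one by rows and one by columns, which cancels the factor
      -- `1 / 2`.
      simp only [add_mul, Finset.sum_add_distrib, ← Finset.mul_sum, hsum']
      rw [Finset.sum_comm]
      simp only [← Finset.mul_sum, hsum]
      ring

/-! ### The variance of a local Hamiltonian -/

theorem QState.expect_ofReal_re {n : ℕ} (ρ : QState n) {A : Op (Fin n)} (hA : A.IsHermitian) :
    ((ρ.expect A).re : ℂ) = ρ.expect A := by
  rw [← Complex.conj_eq_iff_re]
  exact (ρ.expect_conj A).trans (by rw [hA.eq])

/-- The fluctuation of an observable about its expectation value. -/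
def QState.center {n : ℕ} (ρ : QState n) (A : Op (Fin n)) : Op (Fin n) :=
  A - ((ρ.expect A).re : ℂ) • (1 : Op (Fin n))

theorem QState.expect_center_mul {n : ℕ} (ρ : QState n) {A B : Op (Fin n)} (hA : A.IsHermitian)
    (hB : B.IsHermitian) : ρ.expect (ρ.center A * ρ.center B) =
      ρ.expect (A * B) - ρ.expect A * ρ.expect B := by
  rw [center, center, ρ.expect_ofReal_re hA, ρ.expect_ofReal_re hB]
  simp only [sub_mul, mul_sub, smul_mul_assoc, mul_smul_comm, one_mul, mul_one, expect_sub,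
    expect_smul, expect_one]
  ring

theorem QState.expect_center_mul_self_re_le {n : ℕ} (ρ : QState n) {A : Op (Fin n)}
    (hA : A.IsHermitian) (h1 : ‖opCLM A‖ ≤ 1) :
    (ρ.expect (ρ.center A * ρ.center A)).re ≤ 1 := by
  rw [expect_center_mul ρ hA hA, ← ρ.expect_ofReal_re hA, Complex.sub_re, ← Complex.ofReal_mul,
    Complex.ofReal_re]
  linarith [ρ.expect_mul_self_re_le_one hA h1, mul_self_nonneg (ρ.expect A).re]

/-- This is the arithmetic-geometric mean form of Cauchy-Schwarz: expand the nonnegative second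
moment of `A - B`. -/
theorem QState.expect_mul_re_le_one {n : ℕ} (ρ : QState n) {A B : Op (Fin n)}
    (hA : A.IsHermitian) (hB : B.IsHermitian) (hA1 : (ρ.expect (A * A)).re ≤ 1)
    (hB1 : (ρ.expect (B * B)).re ≤ 1) : (ρ.expect (A * B)).re ≤ 1 := by
  have h := ρ.expect_mul_self_re_nonneg (hA.sub hB)
  have hsymm : (ρ.expect (B * A)).re = (ρ.expect (A * B)).re := by
    have h2 := ρ.expect_conj (A * B)
    rw [Matrix.conjTranspose_mul, hA.eq, hB.eq] at h2
    rw [← h2]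
    simp
  simp only [sub_mul, mul_sub, expect_sub, Complex.sub_re, hsymm] at h
  linarith

theorem Circuit.Prepares.uncorrelated {n : ℕ} {C : Circuit n} {ρ : QState n}
    (h : C.Prepares ρ) {S T : Finset (Fin n)}
    (hd : Disjoint (Circuit.lightcone C.reverse S) (Circuit.lightcone C.reverse T)) :
    Uncorrelated ρ.mat S T := by
  rw [← h]
  exact Uncorrelated.circuit_apply C (fun S T => uncorrelated_zeroState) hd

theorem LocalHamiltonian.isHermitian_total {n m K : ℕ} (H : LocalHamiltonian n m K) :
    H.total.IsHermitian := by
  rw [Matrix.IsHermitian, total, Matrix.conjTranspose_sum]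
  exact Finset.sum_congr rfl fun j _ => H.isHermitian j

/-- The quantum Fisher information of a prepared state, in terms of the number of pairs of terms
of the Hamiltonian whose backward lightcones meet. -/
theorem qfi_le_sum_linked {n m K : ℕ} (H : LocalHamiltonian n m K) {ρ : QState n} {C : Circuit n}
    (hC : C.Prepares ρ) :
    open Classical in
    qfi ρ H.total ≤ ∑ j, ((Finset.univ.filter fun k =>
      ¬ Disjoint (Circuit.lightcone C.reverse (supp (H.term j)))
        (Circuit.lightcone C.reverse (supp (H.term k)))).card : ℝ) := by
  classical
  have hsum : H.total - ((∑ j, (ρ.expect (H.term j)).re : ℝ) : ℂ) • (1 : Op (Fin n)) =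
      ∑ j, ρ.center (H.term j) := by
    simp only [QState.center, Finset.sum_sub_distrib, LocalHamiltonian.total, Complex.ofReal_sum,
      Finset.sum_smul]
  refine (qfi_le_expect ρ H.isHermitian_total (∑ j, (ρ.expect (H.term j)).re)).trans ?_
  rw [hsum, Finset.sum_mul_sum, ρ.expect_sum, Complex.re_sum]
  refine Finset.sum_le_sum fun j _ => ?_
  rw [ρ.expect_sum, Complex.re_sum, ← Finset.sum_boole]
  refine Finset.sum_le_sum fun k _ => ?_
  split_ifs with h
  · have hu := hC.uncorrelated h _ _ (actsOn_supp (H.term j)) (actsOn_supp (H.term k))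
    rw [ρ.expect_center_mul (H.isHermitian j) (H.isHermitian k)]
    simp only [QState.expect, ← Matrix.mul_assoc, hu, sub_self, Complex.zero_re, le_refl]
  · exact ρ.expect_mul_re_le_one (isHermitian_sub_smul_one (H.isHermitian j) _)
      (isHermitian_sub_smul_one (H.isHermitian k) _)
      (ρ.expect_center_mul_self_re_le (H.isHermitian j) (H.norm_le_one j))
      (ρ.expect_center_mul_self_re_le (H.isHermitian k) (H.norm_le_one k))

/-- The bound on the quantum Fisher information by the size of lightcones through the circuit run
backwards and then forwards. -/
theorem qfi_le_of_card_lightcone_le {n m K g : ℕ} (H : LocalHamiltonian n m K) {ρ : QState n}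
    {C : Circuit n} (hC : C.Prepares ρ)
    (hg : ∀ q, (Circuit.lightcone (C.reverse ++ C) {q}).card ≤ g) :
    qfi ρ H.total ≤ (m : ℝ) * (K : ℝ) ^ 2 * (g : ℝ) := by
  classical
  refine (qfi_le_sum_linked H hC).trans ?_
  have hcard : ∀ j, (Finset.univ.filter fun k =>
      ¬ Disjoint (Circuit.lightcone C.reverse (supp (H.term j)))
        (Circuit.lightcone C.reverse (supp (H.term k)))).card ≤ K * (g * K) := by
    intro j
    calc _ ≤ ((supp (H.term j)).biUnion fun a =>
          (Circuit.lightcone (C.reverse ++ C) {a}).biUnion fun b =>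
            Finset.univ.filter fun k => b ∈ supp (H.term k)).card := by
          refine Finset.card_le_card fun k hk => ?_
          obtain ⟨a, ha, b, hb, hab⟩ :=
            Circuit.exists_mem_lightcone_of_not_disjoint (Finset.mem_filter.1 hk).2
          simp only [Finset.mem_biUnion, Finset.mem_filter, Finset.mem_univ, true_and]
          exact ⟨a, ha, b, hab, hb⟩
      _ ≤ (supp (H.term j)).card * (g * K) := by
          refine Finset.card_biUnion_le_card_mul _ _ _ fun a _ => ?_
          exact (Finset.card_biUnion_le_card_mul _ _ K fun b _ => H.degree_le b).trans
            (Nat.mul_le_mul_right _ (hg a))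
      _ ≤ K * (g * K) := Nat.mul_le_mul_right _ (H.card_supp_le j)
  calc _ ≤ ∑ _j : Fin m, ((K * (g * K) : ℕ) : ℝ) :=
        Finset.sum_le_sum fun j _ => by exact_mod_cast hcard j
    _ = _ := by
        rw [Finset.sum_const, Finset.card_univ, Fintype.card_fin, nsmul_eq_mul]
        push_cast
        ring

/-! ### Growth of lightcones -/

theorem Circuit.Obeys.reverse_append {n : ℕ} {C : Circuit n} {𝒢 : Connectivity n}
    (h : C.Obeys 𝒢) : Circuit.Obeys (C.reverse ++ C) 𝒢 := by
  intro L hL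
  rw [List.mem_append, List.mem_reverse, or_self] at hL
  exact h L hL

theorem Circuit.depth_reverse_append {n : ℕ} (C : Circuit n) :
    Circuit.depth (C.reverse ++ C) = 2 * C.depth := by
  simp only [Circuit.depth, List.length_append, List.length_reverse]
  omega

theorem Circuit.card_lightcone_le_growth {n : ℕ} {C : Circuit n} {𝒢 : Connectivity n}
    (h : C.Obeys 𝒢) (q : Fin n) : (C.lightcone {q}).card ≤ growth 𝒢 C.depth := by
  refine (Finset.card_le_card fun i hi => ?_).trans
    (Finset.le_sup (f := fun q : Fin n => (diffusion 𝒢 C.depth {q}).card) (Finset.mem_univ q))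
  simp only [diffusion, Finset.mem_filter, Finset.mem_univ, true_and]
  exact ⟨C, rfl, h, hi⟩

/-- By disjointness every qubit lies in just one block, so it contributes at most `κ` qubits to the
cone. -/
theorem Layer.card_lightcone_le {n κ : ℕ} {L : Layer n} (h : ∀ G ∈ L.gates, G.block.card ≤ κ)
    (A : Finset (Fin n)) : (L.lightcone A).card ≤ A.card * κ := by
  classical
  choose G hG hi using L.cover
  refine (Finset.card_le_card (t := A.biUnion fun a => (G a).block) fun i hiL => ?_).trans
    (Finset.card_biUnion_le_card_mul _ _ _ fun a _ => h _ (hG a))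
  obtain ⟨a, ha, G', hG', haG, hiG⟩ := Layer.mem_lightcone.1 hiL
  refine Finset.mem_biUnion.2 ⟨a, ha, ?_⟩
  have : G a = G' := by
    by_contra hne
    exact Finset.disjoint_left.1
      (L.pairwise_disjoint.forall (hG a) hG' hne) (hi a) haG
  rwa [this]

theorem Circuit.card_lightcone_le {n κ : ℕ} {C : Circuit n} (h : C.Obeys (allToAll n κ))
    (A : Finset (Fin n)) : (C.lightcone A).card ≤ A.card * κ ^ C.depth := by
  induction C generalizing A with
  | nil => simp [Circuit.lightcone, Circuit.depth]
  | cons L C ih =>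
    have h1 := ih (fun L' hL' => h L' (List.mem_cons_of_mem _ hL')) (L.lightcone A)
    refine h1.trans ?_
    have h2 := Layer.card_lightcone_le (h L List.mem_cons_self) A
    simp only [Circuit.depth, List.length_cons] at *
    rw [pow_succ', ← mul_assoc]
    exact Nat.mul_le_mul_right _ h2

/-- Sites in a common cube of side `κ` differ by at most `κ - 1` in each coordinate, and the
displacements of the layers add up. -/
theorem Circuit.lightcone_lattice {n κ r : ℕ} {pos : Fin n → Fin r → ℤ} {C : Circuit n}
    (h : C.Obeys (lattice pos κ)) {p q : Fin n} (hq : q ∈ C.lightcone {p}) (i : Fin r) :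
    |pos q i - pos p i| ≤ ((κ : ℤ) - 1) * (Circuit.depth C : ℤ) := by
  induction C generalizing p with
  | nil =>
    rw [Finset.mem_singleton.1 hq]
    simp [Circuit.depth]
  | cons L C ih =>
    obtain ⟨a, ha, hqa⟩ := (Circuit.mem_lightcone (C := C)).1 hq
    have h1 := ih (fun L' hL' => h L' (List.mem_cons_of_mem _ hL')) hqa
    obtain ⟨p', hp', G, hG, hpG, haG⟩ := Layer.mem_lightcone.1 ha
    rw [Finset.mem_singleton.1 hp'] at hpG
    obtain ⟨c, hc⟩ := h L List.mem_cons_self G hG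
    have h2 := hc p hpG i
    have h3 := hc a haG i
    have h4 : |pos a i - pos p i| ≤ (κ : ℤ) - 1 := abs_le.2 ⟨by linarith, by linarith⟩
    have h5 : |pos q i - pos p i| ≤ |pos q i - pos a i| + |pos a i - pos p i| := by
      refine le_of_eq_of_le ?_ (abs_add_le _ _)
      ring_nf
    simp only [Circuit.depth, List.length_cons] at *
    push_cast
    linarith

/-- The box of lattice sites within sup-norm distance `d` of `c`. -/
def latticeBox {r : ℕ} (c : Fin r → ℤ) (d : ℕ) : Finset (Fin r → ℤ) :=
  Fintype.piFinset fun i => Finset.Icc (c i - d) (c i + d)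

theorem mem_latticeBox {r : ℕ} {c v : Fin r → ℤ} {d : ℕ} :
    v ∈ latticeBox c d ↔ ∀ i, |v i - c i| ≤ d := by
  simp only [latticeBox, Fintype.mem_piFinset, Finset.mem_Icc, abs_le]
  exact forall_congr' fun i => ⟨fun h => ⟨by linarith, by linarith⟩,
    fun h => ⟨by linarith, by linarith⟩⟩

theorem card_latticeBox {r : ℕ} (c : Fin r → ℤ) (d : ℕ) :
    (latticeBox c d).card = (2 * d + 1) ^ r := by
  have h : ∀ x : ℤ, (Finset.Icc (x - d) (x + d)).card = 2 * d + 1 := fun x => by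
    rw [Int.card_Icc]; omega
  simp [latticeBox, Fintype.card_piFinset, h]

theorem growth_lattice_le {n κ r : ℕ} {pos : Fin n → Fin r → ℤ} (hκ : 1 ≤ κ)
    (hpos : Function.Injective pos) (t : ℕ) :
    growth (lattice pos κ) t ≤ (2 * ((κ - 1) * t) + 1) ^ r := by
  refine Finset.sup_le fun q _ => ?_
  rw [← card_latticeBox (pos q), ← Finset.card_image_of_injective _ hpos]
  refine Finset.card_le_card fun v hv => ?_
  obtain ⟨p, hp, rfl⟩ := Finset.mem_image.1 hv
  simp only [diffusion, Finset.mem_filter, Finset.mem_univ, true_and] at hp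
  obtain ⟨C, rfl, hC, hp⟩ := hp
  refine mem_latticeBox.2 fun i => ?_
  push_cast [Nat.cast_sub hκ]
  exact Circuit.lightcone_lattice hC hp i

/-- The identity channel. -/
def Channel.id (d : Type) [Fintype d] : Channel d where
  toLin := LinearMap.id
  completelyPositive _ _ h := h
  tracePreserving _ := rfl

/-- The layer with the identity channel on the pair `{p, q}` and on every other single qubit. -/
def Layer.pair {n : ℕ} (p q : Fin n) : Layer n where
  gates := ⟨{p, q}, Channel.id _⟩ ::
    ((List.finRange n).filter fun i => i ≠ p ∧ i ≠ q).map fun i => ⟨{i}, Channel.id _⟩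
  pairwise_disjoint := by
    rw [List.pairwise_cons]
    constructor
    · intro G hG
      obtain ⟨i, hi, rfl⟩ := List.mem_map.1 hG
      have := (List.mem_filter.1 hi).2
      simpa using this
    · rw [List.pairwise_map]
      refine ((List.nodup_finRange n).filter _).imp fun h => ?_
      simpa using h
  cover i := by
    by_cases h : i = p ∨ i = q
    · exact ⟨_, List.mem_cons_self, by simpa using h⟩
    · refine ⟨⟨{i}, Channel.id _⟩, List.mem_cons_of_mem _ (List.mem_map.2 ⟨i, ?_, rfl⟩), by simp⟩
      simpa [List.mem_filter] using h

theorem Layer.mem_lightcone_pair {n : ℕ} (p q : Fin n) : q ∈ (Layer.pair p q).lightcone {p} :=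
  Layer.mem_lightcone.2 ⟨p, by simp, _, List.mem_cons_self, by simp, by simp⟩

theorem Layer.pair_blocks_lattice {n κ r : ℕ} {pos : Fin n → Fin r → ℤ} (hκ : 1 ≤ κ) {p q : Fin n}
    (h : ∀ i, |pos q i - pos p i| ≤ (κ : ℤ) - 1) :
    ∀ G ∈ (Layer.pair p q).gates, G.block ∈ lattice pos κ := by
  have hκ' : (1 : ℤ) ≤ κ := by exact_mod_cast hκ
  intro G hG
  rcases List.mem_cons.1 hG with rfl | hG
  -- The coordinatewise minimum is the lowest corner of a cube containing both sites.
  · refine ⟨fun i => min (pos p i) (pos q i), fun j hj i => ?_⟩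
    have h1 := abs_le.1 (h i)
    rcases Finset.mem_insert.1 hj with rfl | hj
    · exact ⟨min_le_left _ _, by rcases min_cases (pos j i) (pos q i) with h2 | h2 <;> linarith⟩
    · rw [Finset.mem_singleton.1 hj]
      exact ⟨min_le_right _ _, by rcases min_cases (pos p i) (pos q i) with h2 | h2 <;> linarith⟩
  · obtain ⟨a, -, rfl⟩ := List.mem_map.1 hG
    refine ⟨pos a, fun j hj i => ?_⟩
    rw [Finset.mem_singleton.1 hj]
    exact ⟨le_rfl, by linarith⟩

/-- A number within distance `k (t + 1)` of `x` is within `k` of a number within `k t` of `x`. -/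
theorem exists_intermediate {k t x y : ℤ} (hk : 0 ≤ k) (ht : 0 ≤ t)
    (h : |y - x| ≤ k * (t + 1)) : ∃ z, |z - x| ≤ k * t ∧ |y - z| ≤ k := by
  have hkt := mul_nonneg hk ht
  rw [abs_le] at h
  -- The witness is `y` clamped to the interval of radius `k * t` about `x`.
  refine ⟨max (x - k * t) (min (x + k * t) y), ?_, ?_⟩
  · rw [abs_le]
    constructor
    · linarith [le_max_left (x - k * t) (min (x + k * t) y)]
    · linarith [max_le (show x - k * t ≤ x + k * t by linarith) (min_le_left (x + k * t) y)]
  · rw [abs_le]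
    rcases max_cases (x - k * t) (min (x + k * t) y) with h1 | h1 <;>
    rcases min_cases (x + k * t) y with h2 | h2 <;> constructor <;> linarith

/-- Inside a box of occupied sites, every site is reached as fast as the lattice permits. -/
theorem exists_circuit_lattice {n κ r : ℕ} {pos : Fin n → Fin r → ℤ} (hκ : 1 ≤ κ) {q : Fin n}
    (t : ℕ) (hbox : ∀ v : Fin r → ℤ, (∀ i, |v i - pos q i| ≤ ((κ : ℤ) - 1) * (t : ℤ)) →
      ∃ q', pos q' = v) {p : Fin n}
    (hp : ∀ i, |pos p i - pos q i| ≤ ((κ : ℤ) - 1) * (t : ℤ)) (hpos : Function.Injective pos) :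
    ∃ C : Circuit n, C.depth = t ∧ C.Obeys (lattice pos κ) ∧ p ∈ C.lightcone {q} := by
  have hκ' : (0 : ℤ) ≤ (κ : ℤ) - 1 := by
    have : (1 : ℤ) ≤ κ := by exact_mod_cast hκ
    linarith
  induction t generalizing p with
  | zero =>
    refine ⟨[], rfl, fun L hL => absurd hL List.not_mem_nil, ?_⟩
    have : p = q := hpos (funext fun i => by simpa [sub_eq_zero] using hp i)
    rw [this]
    exact Finset.mem_singleton_self q
  | succ t ih =>
    push_cast at hp hbox
    -- Clamping each coordinate separately yields a site one layer away from `p`; it is occupied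
    -- because it lies in the box.
    choose z hz hpz using fun i => exists_intermediate hκ' (Int.natCast_nonneg t) (hp i)
    have hle : ((κ : ℤ) - 1) * t ≤ ((κ : ℤ) - 1) * (t + 1) := by linarith
    obtain ⟨a, ha⟩ := hbox z fun i => (hz i).trans hle
    obtain ⟨C, hC, hO, hmem⟩ := ih (p := a) (fun v hv => hbox v fun i => (hv i).trans hle)
      (by rw [ha]; exact hz)
    refine ⟨C ++ [Layer.pair a p], ?_, ?_, ?_⟩
    · simpa [Circuit.depth] using hC
    · intro L hL
      rcases List.mem_append.1 hL with hL | hL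
      · exact hO L hL
      · rw [List.mem_singleton.1 hL]
        exact Layer.pair_blocks_lattice hκ (by rw [ha]; exact hpz)
    · rw [Circuit.lightcone_append]
      obtain ⟨b, hb, h⟩ := Layer.mem_lightcone.1 (Layer.mem_lightcone_pair a p)
      rw [Finset.mem_singleton.1 hb] at h
      exact Layer.mem_lightcone.2 ⟨a, hmem, h⟩

/-- Each site of the box may use its own circuit, since the growth function counts the union of
cones over all circuits. -/
theorem le_growth_lattice {n κ r : ℕ} {pos : Fin n → Fin r → ℤ} (hκ : 1 ≤ κ)
    (hpos : Function.Injective pos) (t : ℕ) (q : Fin n)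
    (hbox : ∀ v : Fin r → ℤ, (∀ i, |v i - pos q i| ≤ ((κ : ℤ) - 1) * (t : ℤ)) →
      ∃ q', pos q' = v) :
    (2 * ((κ - 1) * t) + 1) ^ r ≤ growth (lattice pos κ) t := by
  refine le_trans ?_ (Finset.le_sup (f := fun q : Fin n => (diffusion (lattice pos κ) t {q}).card)
    (Finset.mem_univ q))
  rw [← card_latticeBox (pos q), ← Finset.card_image_of_injective _ hpos]
  refine Finset.card_le_card fun v hv => ?_
  have hv' := mem_latticeBox.1 hv
  push_cast [Nat.cast_sub hκ] at hv'
  obtain ⟨p, rfl⟩ := hbox v hv'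
  refine Finset.mem_image_of_mem _ ?_
  simp only [diffusion, Finset.mem_filter, Finset.mem_univ, true_and]
  exact exists_circuit_lattice hκ t hbox hv' hpos

theorem qfi_le_growth {n m K : ℕ} {𝒢 : Connectivity n} (H : LocalHamiltonian n m K)
    {ρ : QState n} {C : Circuit n} (hO : C.Obeys 𝒢) (hC : C.Prepares ρ) :
    qfi ρ H.total ≤ (m : ℝ) * (K : ℝ) ^ 2 * (growth 𝒢 (2 * C.depth) : ℝ) :=
  qfi_le_of_card_lightcone_le H hC fun q => by
    rw [← Circuit.depth_reverse_append]
    exact Circuit.card_lightcone_le_growth hO.reverse_append q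

theorem qfi_le_allToAll {n m K κ : ℕ} (H : LocalHamiltonian n m K)
    {ρ : QState n} {C : Circuit n} (hO : C.Obeys (allToAll n κ)) (hC : C.Prepares ρ) :
    qfi ρ H.total ≤ (m : ℝ) * (K : ℝ) ^ 2 * (κ : ℝ) ^ (2 * C.depth) := by
  rw [← Nat.cast_pow κ]
  refine qfi_le_of_card_lightcone_le H hC fun q => ?_
  have h := Circuit.card_lightcone_le hO.reverse_append {q}
  rwa [Circuit.depth_reverse_append, Finset.card_singleton, one_mul] at h

/-- A bound on the quantum Fisher information that is uniform over bounded depths. -/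
theorem qfi_le_of_depth_le {n m K κ T : ℕ} {c : ℝ} (H : LocalHamiltonian n m K)
    {ρ : QState n} {C : Circuit n} (hm : (m : ℝ) ≤ c * (n : ℝ)) (hT : C.depth ≤ T)
    (hO : C.Obeys (allToAll n κ)) (hC : C.Prepares ρ) :
    qfi ρ H.total ≤ c * (K : ℝ) ^ 2 * ((κ : ℝ) + 1) ^ (2 * T) * (n : ℝ) := by
  have hκ : (0 : ℝ) ≤ κ := Nat.cast_nonneg κ
  calc qfi ρ H.total ≤ (m : ℝ) * (K : ℝ) ^ 2 * (κ : ℝ) ^ (2 * C.depth) := qfi_le_allToAll H hO hC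
    _ ≤ (c * n) * (K : ℝ) ^ 2 * ((κ : ℝ) + 1) ^ (2 * T) := by
      refine mul_le_mul (mul_le_mul_of_nonneg_right hm (sq_nonneg _)) ?_ (by positivity)
        (mul_nonneg ((Nat.cast_nonneg m).trans hm) (sq_nonneg _))
      -- The base `κ + 1` is at least `1` even for `κ = 0`, so the power is monotone in the depth.
      exact (pow_le_pow_left₀ hκ (by linarith) _).trans
        (pow_le_pow_right₀ (by linarith) (by omega))
    _ = _ := by ring

end ShallowQFI

end

theorem theorem1 :
    -- the bound through the lightcone growth function of an arbitrary connectivity constraint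
    (∀ (n m K t : ℕ) (𝒢 : Connectivity n) (H : LocalHamiltonian n m K) (ρ : QState n)
        (C : Circuit n), C.depth = t → C.Obeys 𝒢 → C.Prepares ρ →
        qfi ρ H.total ≤ (m : ℝ) * (K : ℝ) ^ 2 * (growth 𝒢 (2 * t) : ℝ)) ∧
    -- all-to-all connectivity: the bound with `κ ^ (2t)`
    (∀ (n m K κ t : ℕ) (H : LocalHamiltonian n m K) (ρ : QState n)
        (C : Circuit n), C.depth = t → C.Obeys (allToAll n κ) → C.Prepares ρ →
        qfi ρ H.total ≤ (m : ℝ) * (K : ℝ) ^ 2 * (κ : ℝ) ^ (2 * t)) ∧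
    -- `r` dimensions: the bound with `(2(κ-1)(2t)+1)^r`
    (∀ (n m K κ t r : ℕ) (pos : Fin n → Fin r → ℤ) (H : LocalHamiltonian n m K) (ρ : QState n)
        (C : Circuit n), 1 ≤ κ → Function.Injective pos →
        C.depth = t → C.Obeys (lattice pos κ) → C.Prepares ρ →
        qfi ρ H.total ≤
          (m : ℝ) * (K : ℝ) ^ 2 * (2 * ((κ : ℝ) - 1) * (2 * (t : ℝ)) + 1) ^ r) ∧
    -- `r` dimensions: the growth function is at most `(2(κ-1)t+1)^r`, and equal to it as soon as
    -- some site is surrounded by a sufficiently large full box of sites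
    (∀ (n κ t r : ℕ) (pos : Fin n → Fin r → ℤ), 1 ≤ κ → Function.Injective pos →
        (growth (lattice pos κ) t : ℝ) ≤ (2 * ((κ : ℝ) - 1) * (t : ℝ) + 1) ^ r ∧
        ((∃ q : Fin n, ∀ v : Fin r → ℤ,
            (∀ i, |v i - pos q i| ≤ ((κ : ℤ) - 1) * (t : ℤ)) → ∃ q', pos q' = v) →
          (growth (lattice pos κ) t : ℝ) = (2 * ((κ : ℝ) - 1) * (t : ℝ) + 1) ^ r)) ∧
    -- shallow circuits: the quantum Fisher information is `O(n)`, with a uniform constant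
    (∀ (K κ T : ℕ) (c : ℝ), ∃ c' : ℝ, ∀ (n m : ℕ) (H : LocalHamiltonian n m K) (ρ : QState n)
        (C : Circuit n), (m : ℝ) ≤ c * (n : ℝ) →
        C.depth ≤ T → C.Obeys (allToAll n κ) → C.Prepares ρ →
        qfi ρ H.total ≤ c' * (n : ℝ)) ∧
    -- beating this scaling requires long-range entanglement
    (∀ (K : ℕ) (n m : ℕ → ℕ) (H : ∀ k, LocalHamiltonian (n k) (m k) K) (ρ : ∀ k, QState (n k)),
        ((fun k => (m k : ℝ)) =O[atTop] fun k => (n k : ℝ)) →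
        (¬ (fun k => qfi (ρ k) (H k).total) =O[atTop] fun k => (n k : ℝ)) →
        IsLongRangeEntangled ρ) := by
  refine ⟨?_, ?_, ?_, ?_, ?_, ?_⟩
  · rintro n m K t 𝒢 H ρ C rfl hO hC
    exact qfi_le_growth H hO hC
  · rintro n m K κ t H ρ C rfl hO hC
    exact qfi_le_allToAll H hO hC
  · rintro n m K κ t r pos H ρ C hκ hpos rfl hO hC
    refine (qfi_le_growth H hO hC).trans (mul_le_mul_of_nonneg_left ?_ (by positivity))
    refine (Nat.cast_le.2 (growth_lattice_le hκ hpos _)).trans_eq ?_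
    push_cast [Nat.cast_sub hκ]
    ring
  · intro n κ t r pos hκ hpos
    have hcast : (((2 * ((κ - 1) * t) + 1) ^ r : ℕ) : ℝ) =
        (2 * ((κ : ℝ) - 1) * (t : ℝ) + 1) ^ r := by
      push_cast [Nat.cast_sub hκ]
      ring
    rw [← hcast]
    refine ⟨Nat.cast_le.2 (growth_lattice_le hκ hpos t), ?_⟩
    rintro ⟨q, hq⟩
    exact congrArg Nat.cast
      (le_antisymm (growth_lattice_le hκ hpos t) (le_growth_lattice hκ hpos t q hq))
  · intro K κ T c
    exact ⟨c * (K : ℝ) ^ 2 * ((κ : ℝ) + 1) ^ (2 * T), fun n m H ρ C hm hT hO hC =>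
      qfi_le_of_depth_le H hm hT hO hC⟩
  · rintro K n m H ρ hm hF ⟨κ, T, hs⟩
    obtain ⟨c, hc⟩ := hm.bound
    refine hF (IsBigO.of_bound (c * (K : ℝ) ^ 2 * ((κ : ℝ) + 1) ^ (2 * T)) ?_)
    filter_upwards [hc] with k hk
    obtain ⟨C, hT, hO, hC⟩ := hs k
    rw [Real.norm_natCast, Real.norm_natCast] at hk
    -- Nonnegativity turns the norm in the asymptotic bound into the Fisher information itself.
    rw [Real.norm_natCast, Real.norm_of_nonneg (qfi_nonneg _ _)]
    exact qfi_le_of_depth_le (H k) hk hT hO hC
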